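/- A \emph{bitopological space} is a set $S$ with two topologies $\mathcal T^+$ and $\mathcal T^-$. Put $\mathcal L^+=\{U\in\mathcal T^+ : S\setminus U\in\mathcal T^-\}$ and $\mathcal L^-=\{U\in\mathcal T^- : S\setminus U\in\mathcal T^+\}$. A non-empty bitopological space $(S,\mathcal T^+,\mathcal T^-)$ is an \emph{abstract spectrum} if (SP1) $\mathcal L^+$ is a base for $\mathcal T^+$ and $\mathcal L^-$ is a base for $\mathcal T^-$; (SP2) every $\mathcal T^+$-closed subset of $S$ is compact in $(S,\mathcal T^-)$, and every $\mathcal T^-$-closed subset of $S$ is compact in $(S,\mathcal T^+)$ (compact: every open cover has a finite subcover); (SP3) at least one of $(S,\mathcal T^+)$ and $(S,\mathcal T^-)$ is a $T_0$-space. Let $\mathbf S$ be the category of abstract spectra, whose morphisms are the maps that are continuous both for the topologies $\mathcal T^+$ and for the topologies $\mathcal T^-$, and let $\mathbf S_\emptyset$ be the category obtained in the same way when the empty bitopological space is admitted as an abstract spectrum. Let $\mathbf{DLat}$ be the category of distributive lattices with $0$ and $1$ (where $0=1$ is allowed) and lattice homomorphisms preserving $0$ and $1$, and let $\mathbf{DLat}_{0\ne1}$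 be its full subcategory of lattices with $0\neq 1$. \textbf{Corollary 2.3.12.} The categories $\mathbf S_\emptyset$ and $\mathbf{DLat}$ are dually equivalent, i.e. $\mathbf S_\emptyset^{\mathrm{op}}$ is equivalent to $\mathbf{DLat}$; and the categories $\mathbf S$ and $\mathbf{DLat}_{0\ne1}$ are dually equivalent. -/

import Mathlib

open CategoryTheory Topology

universe u

/-- A bitopological space `(S, 𝒯⁺, 𝒯⁻)`: a set with two topologies (no further condition). -/
structure BitopSpace where
  carrier : Type u
  pos : TopologicalSpace carrier
  neg : TopologicalSpace carrier

namespace BitopSpace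

/-- `ℒ⁺`: the `𝒯⁺`-open sets whose complement is `𝒯⁻`-open. -/
def posLat (X : BitopSpace.{u}) : Set (Set X.carrier) :=
  {U | IsOpen[X.pos] U ∧ IsOpen[X.neg] Uᶜ}

/-- `ℒ⁻`: the `𝒯⁻`-open sets whose complement is `𝒯⁺`-open. -/
def negLat (X : BitopSpace.{u}) : Set (Set X.carrier) :=
  {U | IsOpen[X.neg] U ∧ IsOpen[X.pos] Uᶜ}

/-- Maps continuous for both the positive and the negative topologies. -/
@[ext]
structure Hom (X Y : BitopSpace.{u}) where
  toFun : X.carrier → Y.carrier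
  continuous_pos : @Continuous X.carrier Y.carrier X.pos Y.pos toFun
  continuous_neg : @Continuous X.carrier Y.carrier X.neg Y.neg toFun

/-- Bitopological spaces and bicontinuous maps, with composition of functions. -/
instance : Category BitopSpace.{u} where
  Hom X Y := Hom X Y
  id X := ⟨id, @continuous_id _ X.pos, @continuous_id _ X.neg⟩
  comp {X Y Z} f g := ⟨g.toFun ∘ f.toFun,
    @Continuous.comp _ _ _ X.pos Y.pos Z.pos _ _ g.continuous_pos f.continuous_pos,
    @Continuous.comp _ _ _ X.neg Y.neg Z.neg _ _ g.continuous_neg f.continuous_neg⟩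

/-- The axioms of an abstract spectrum, apart from non-emptiness. -/
structure SpectrumAxioms (X : BitopSpace.{u}) : Prop where
  /-- `ℒ⁺` is a base for `𝒯⁺`. -/
  basis_pos : @TopologicalSpace.IsTopologicalBasis X.carrier X.pos X.posLat
  /-- `ℒ⁻` is a base for `𝒯⁻`. -/
  basis_neg : @TopologicalSpace.IsTopologicalBasis X.carrier X.neg X.negLat
  /-- `𝒯⁺`-closed sets are `𝒯⁻`-compact (every open cover has a finite subcover). -/
  compact_neg : ∀ F : Set X.carrier, IsOpen[X.pos] Fᶜ → @IsCompact X.carrier X.neg F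
  /-- `𝒯⁻`-closed sets are `𝒯⁺`-compact. -/
  compact_pos : ∀ F : Set X.carrier, IsOpen[X.neg] Fᶜ → @IsCompact X.carrier X.pos F
  /-- At least one of the two topologies is `T₀`. -/
  t0 : @T0Space X.carrier X.pos ∨ @T0Space X.carrier X.neg

/-- Abstract spectra: non-empty bitopological spaces satisfying the axioms. -/
def isAbstractSpectrum : ObjectProperty BitopSpace.{u} :=
  fun X => Nonempty X.carrier ∧ X.SpectrumAxioms

/-- The same axioms, with the empty bitopological space admitted. -/
def isPossiblyEmptyAbstractSpectrum : ObjectProperty BitopSpace.{u} :=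
  fun X => X.SpectrumAxioms

end BitopSpace

/-- The category of (non-empty) abstract spectra; its morphisms are the bicontinuous maps. -/
abbrev AbstractSpectrum : Type (u + 1) :=
  BitopSpace.isAbstractSpectrum.{u}.FullSubcategory

/-- The category of abstract spectra, together with the empty one. -/
abbrev PossiblyEmptyAbstractSpectrum : Type (u + 1) :=
  BitopSpace.isPossiblyEmptyAbstractSpectrum.{u}.FullSubcategory

/-- Bounded distributive lattices with `0 ≠ 1`. -/
def BddDistLat.isNontrivial : ObjectProperty BddDistLat.{u} :=
  fun L => (⊥ : L) ≠ ⊤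

/-- The full subcategory of bounded distributive lattices with `0 ≠ 1`. -/
abbrev NontrivialBddDistLat : Type (u + 1) :=
  BddDistLat.isNontrivial.{u}.FullSubcategory

/-!
The patch topology of a bitopological space is the join of `𝒯⁺` and `𝒯⁻`. Axiom (SP2) says exactly
that it is compact, and the members of `ℒ⁺` are patch-clopen. Hence in an abstract spectrum every
prime filter of `ℒ⁺` consists of the members of `ℒ⁺` containing some point, and this point is unique
by (SP1) and (SP3). A bicontinuous map therefore amounts to a homomorphism between the lattices
`ℒ⁺`, so that `ℒ⁺` is a fully faithful contravariant functor. Conversely, the prime filters of a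
distributive lattice `L` form an abstract spectrum, patch compactness being the fact that an
ultrafilter on them converges to the prime filter of those `a` with `{x | a ∈ x}` in the
ultrafilter; and `L` is its lattice `ℒ⁺` because prime filters separate elements.
-/

open Set TopologicalSpace Filter

theorem isCompact_of_isClosed_of_compactSpace_inf {α : Type*} {s t : TopologicalSpace α}
    (hst : @CompactSpace α (s ⊓ t)) {F : Set α} (hF : IsClosed[s] F) : @IsCompact α t F := by
  have hF_inf : IsClosed[s ⊓ t] F := hF.mono inf_le_left
  have hF_compact : @IsCompact α (s ⊓ t) F := @IsClosed.isCompact α (s ⊓ t) F hst hF_inf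
  simpa only [image_id] using
    @IsCompact.image α α (s ⊓ t) t F id hF_compact (continuous_id_of_le inf_le_right)

theorem compactSpace_inf_iff {α : Type*} {s t : TopologicalSpace α} :
    @CompactSpace α (s ⊓ t) ↔
      (∀ F, IsClosed[s] F → @IsCompact α t F) ∧ ∀ F, IsClosed[t] F → @IsCompact α s F := by
  refine ⟨fun h => ⟨fun _ => isCompact_of_isClosed_of_compactSpace_inf h,
    fun _ => isCompact_of_isClosed_of_compactSpace_inf (inf_comm s t ▸ h)⟩, fun ⟨hs, ht⟩ => ?_⟩
  rw [← @isCompact_univ_iff α (s ⊓ t), @isCompact_iff_ultrafilter_le_nhds α (s ⊓ t)]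
  intro 𝒰 _
  simp only [mem_univ, true_and, @nhds_inf α s t, le_inf_iff]
  -- The `s`-limits of `𝒰` form an `s`-closed, hence `t`-compact set `F`. If none of them were a
  -- `t`-limit, `𝒰` would contain a `t`-closed set `Vᶜ` disjoint from `F`. But `Vᶜ` is `s`-compact,
  -- so that `𝒰` has an `s`-limit in it.
  by_contra! h_no_limit
  let F : Set α := {x | (𝒰 : Filter α) ≤ @nhds α s x}
  have hF : IsClosed[s] F := by
    simpa only [Ultrafilter.clusterPt_iff] using @isClosed_setOfPred_clusterPt α s 𝒰
  have h_disjoint : Disjoint (@nhdsSet α t F) 𝒰 :=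
    (@IsCompact.disjoint_nhdsSet_left α t _ _ (hs F hF)).2 fun x hx =>
      (Ultrafilter.disjoint_iff_not_le.2 (h_no_limit x hx)).symm
  obtain ⟨V, ⟨hV, hFV⟩, hV𝒰⟩ := (@hasBasis_nhdsSet α t F).disjoint_iff_left.1 h_disjoint
  obtain ⟨x, hxV, hx⟩ := (@isCompact_iff_ultrafilter_le_nhds α s Vᶜ).1
    (ht _ (@IsOpen.isClosed_compl α t V hV)) 𝒰 (le_principal_iff.2 hV𝒰)
  exact hxV (hFV hx)

namespace BitopSpace

/-- The patch topology of a bitopological space, generated by its two topologies. The order on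
`TopologicalSpace` has finer topologies smaller, so that it is their infimum. -/
abbrev patch (X : BitopSpace.{u}) : TopologicalSpace X.carrier :=
  X.pos ⊓ X.neg

theorem compactSpace_patch_iff {X : BitopSpace.{u}} :
    @CompactSpace _ X.patch ↔
      (∀ F : Set X.carrier, IsOpen[X.pos] Fᶜ → @IsCompact _ X.neg F) ∧
        ∀ F : Set X.carrier, IsOpen[X.neg] Fᶜ → @IsCompact _ X.pos F := by
  simp only [isOpen_compl_iff, compactSpace_inf_iff]

section PosLat

variable {X Y : BitopSpace.{u}}

theorem compl_mem_posLat_iff {U : Set X.carrier} : Uᶜ ∈ X.posLat ↔ U ∈ X.negLat := by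
  simp only [posLat, negLat, mem_ofPred_eq, compl_compl, and_comm]

theorem compl_mem_negLat_iff {U : Set X.carrier} : Uᶜ ∈ X.negLat ↔ U ∈ X.posLat := by
  rw [← compl_mem_posLat_iff, compl_compl]

theorem empty_mem_posLat : ∅ ∈ X.posLat :=
  ⟨@isOpen_empty _ X.pos, by rw [compl_empty]; exact @isOpen_univ _ X.neg⟩

theorem univ_mem_posLat : univ ∈ X.posLat :=
  ⟨@isOpen_univ _ X.pos, by rw [compl_univ]; exact @isOpen_empty _ X.neg⟩

theorem union_mem_posLat {U V : Set X.carrier} (hU : U ∈ X.posLat) (hV : V ∈ X.posLat) :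
    U ∪ V ∈ X.posLat :=
  ⟨@IsOpen.union _ _ _ X.pos hU.1 hV.1, by
    rw [compl_union]; exact @IsOpen.inter _ X.neg _ _ hU.2 hV.2⟩

theorem inter_mem_posLat {U V : Set X.carrier} (hU : U ∈ X.posLat) (hV : V ∈ X.posLat) :
    U ∩ V ∈ X.posLat :=
  ⟨@IsOpen.inter _ X.pos _ _ hU.1 hV.1, by
    rw [compl_inter]; exact @IsOpen.union _ _ _ X.neg hU.2 hV.2⟩

theorem isClopen_patch_of_mem_posLat {U : Set X.carrier} (hU : U ∈ X.posLat) :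
    @IsClopen _ X.patch U :=
  ⟨(@isOpen_compl_iff _ _ X.patch).1 (hU.2.mono inf_le_right), hU.1.mono inf_le_left⟩

variable (X) in
/-- The lattice `ℒ⁺` of a bitopological space, as a sublattice of the power set. -/
def posSublattice : Sublattice (Set X.carrier) where
  carrier := X.posLat
  supClosed' _ hU _ hV := union_mem_posLat hU hV
  infClosed' _ hU _ hV := inter_mem_posLat hU hV

instance : BoundedOrder X.posSublattice :=
  Subtype.boundedOrder empty_mem_posLat univ_mem_posLat

theorem bot_ne_top_posSublattice_iff :
    (⊥ : X.posSublattice) ≠ ⊤ ↔ Nonempty X.carrier := by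
  rw [ne_comm, Ne, Subtype.ext_iff]
  exact nonempty_iff_ne_empty.symm.trans nonempty_iff_univ_nonempty.symm

/-- The preimage map of a bicontinuous map, as a homomorphism between the lattices `ℒ⁺`. -/
def Hom.preimage (f : Hom X Y) : BoundedLatticeHom Y.posSublattice X.posSublattice where
  toFun U := ⟨f.toFun ⁻¹' U,
    @IsOpen.preimage _ _ X.pos Y.pos _ f.continuous_pos _ U.2.1,
    @IsOpen.preimage _ _ X.neg Y.neg _ f.continuous_neg _ U.2.2⟩
  map_sup' _ _ := rfl
  map_inf' _ _ := rfl
  map_top' := rfl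
  map_bot' := rfl

/-- The prime filter of the members of `ℒ⁺` containing a point. As everywhere below, a prime filter
is encoded as the homomorphism to `Prop` deciding membership in it. -/
def pointFilter (x : X.carrier) : BoundedLatticeHom X.posSublattice Prop where
  toFun U := x ∈ (U : Set X.carrier)
  map_sup' _ _ := rfl
  map_inf' _ _ := rfl
  map_top' := rfl
  map_bot' := rfl

theorem pointFilter_eq_iff {x : X.carrier} {p : BoundedLatticeHom X.posSublattice Prop} :
    pointFilter x = p ↔ ∀ U : X.posSublattice, x ∈ (U : Set X.carrier) ↔ p U :=
  DFunLike.ext_iff.trans (forall_congr' fun _ => eq_iff_iff)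

theorem pointFilter_surjective (h : @CompactSpace _ X.patch) :
    Function.Surjective (pointFilter (X := X)) := by
  intro p
  let _ := X.patch
  let C (W : {U // p U} × {V // ¬ p V}) : Set X.carrier := (W.1.1 : Set X.carrier) \ W.2.1
  have hC_closed W : IsClosed (C W) :=
    ((isClopen_patch_of_mem_posLat W.1.1.2).diff (isClopen_patch_of_mem_posLat W.2.1.2)).isClosed
  have hC_nonempty W : (C W).Nonempty :=
    sdiff_nonempty.2 fun hUV => W.2.2 (OrderHomClass.mono p (show W.1.1 ≤ W.2.1 from hUV) W.1.2)
  have hC_directed : Directed (· ⊇ ·) C := fun W W' =>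
    ⟨⟨⟨W.1.1 ⊓ W'.1.1, by simp [W.1.2, W'.1.2]⟩, ⟨W.2.1 ⊔ W'.2.1, by simp [W.2.2, W'.2.2]⟩⟩,
      sdiff_subset_sdiff inter_subset_left subset_union_left,
      sdiff_subset_sdiff inter_subset_right subset_union_right⟩
  have htop : p ⊤ := by simp
  have hbot : ¬ p ⊥ := by simp
  have : Nonempty ({U // p U} × {V // ¬ p V}) := ⟨⟨⊤, htop⟩, ⟨⊥, hbot⟩⟩
  obtain ⟨x, hx⟩ := IsCompact.nonempty_iInter_of_directed_nonempty_isCompact_isClosed C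
    hC_directed hC_nonempty (fun W => (hC_closed W).isCompact) hC_closed
  rw [mem_iInter] at hx
  refine ⟨x, pointFilter_eq_iff.2 fun U => ⟨fun hxU => ?_, fun hU => (hx ⟨⟨U, hU⟩, ⟨⊥, hbot⟩⟩).1⟩⟩
  by_contra hU
  exact (hx ⟨⟨⊤, htop⟩, ⟨U, hU⟩⟩).2 hxU

end PosLat

namespace SpectrumAxioms

variable {X Y : BitopSpace.{u}}

theorem compactSpace_patch (h : X.SpectrumAxioms) : @CompactSpace _ X.patch :=
  compactSpace_patch_iff.2 ⟨h.compact_neg, h.compact_pos⟩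

theorem pointFilter_injective (h : X.SpectrumAxioms) :
    Function.Injective (pointFilter (X := X)) := by
  intro x y hxy
  have hmem : ∀ U ∈ X.posLat, x ∈ U ↔ y ∈ U := fun U hU => pointFilter_eq_iff.1 hxy ⟨U, hU⟩
  rcases h.t0 with h0 | h0
  · let _ := X.pos
    exact (h.basis_pos.inseparable_iff.2 hmem).eq
  · let _ := X.neg
    refine (h.basis_neg.inseparable_iff.2 fun U hU => ?_).eq
    simpa using not_congr (hmem Uᶜ (compl_mem_posLat_iff.2 hU))

/-- A map into an abstract spectrum that pulls `ℒ⁺` back into `ℒ⁺`, as a bicontinuous map. -/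
def homOfPreimageMem (hY : Y.SpectrumAxioms) (f : X.carrier → Y.carrier)
    (hf : ∀ U ∈ Y.posLat, f ⁻¹' U ∈ X.posLat) : Hom X Y where
  toFun := f
  continuous_pos :=
    (@IsTopologicalBasis.continuous_iff _ _ X.pos Y.pos _ hY.basis_pos f).2 fun U hU => (hf U hU).1
  continuous_neg :=
    (@IsTopologicalBasis.continuous_iff _ _ X.neg Y.neg _ hY.basis_neg f).2 fun U hU =>
      (compl_mem_posLat_iff.1 (hf Uᶜ (compl_mem_posLat_iff.2 hU))).1

theorem preimage_bijective (hY : Y.SpectrumAxioms) :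
    Function.Bijective (Hom.preimage : Hom X Y → _) := by
  constructor
  · intro f g hfg
    have h_point (x : X.carrier) : pointFilter (f.toFun x) = pointFilter (g.toFun x) :=
      congrArg (BoundedLatticeHom.comp (pointFilter x)) hfg
    exact Hom.ext (funext fun x => hY.pointFilter_injective (h_point x))
  · intro φ
    choose f hf using fun x : X.carrier =>
      pointFilter_surjective hY.compactSpace_patch ((pointFilter x).comp φ)
    have hpre (U : Y.posSublattice) : f ⁻¹' U = φ U :=
      Set.ext fun x => pointFilter_eq_iff.1 (hf x) U
    exact ⟨hY.homOfPreimageMem f fun U hU => hpre ⟨U, hU⟩ ▸ (φ ⟨U, hU⟩).2,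
      DFunLike.ext _ _ fun U => Subtype.ext (hpre U)⟩

end SpectrumAxioms

section PrimeSpace

variable {L : Type u} [Lattice L] [BoundedOrder L]

/-- The set of prime filters of a bounded lattice containing a given element. -/
def basicOpen (a : L) : Set (BoundedLatticeHom L Prop) := {x | x a}

theorem basicOpen_sup (a b : L) : basicOpen (a ⊔ b) = basicOpen a ∪ basicOpen b := by
  ext x; simp [basicOpen]

theorem basicOpen_inf (a b : L) : basicOpen (a ⊓ b) = basicOpen a ∩ basicOpen b := by
  ext x; simp [basicOpen]

theorem basicOpen_top : basicOpen (⊤ : L) = univ := by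
  ext x; simp [basicOpen]

theorem basicOpen_bot : basicOpen (⊥ : L) = ∅ := by
  ext x; simp [basicOpen]

theorem basicOpen_finset_sup (s : Finset L) : basicOpen (s.sup id) = ⋃ a ∈ s, basicOpen a := by
  ext x; simp [basicOpen, map_finset_sup, Finset.sup_eq_iSup]

variable (L) in
/-- The bitopological space of prime filters of a bounded lattice: `𝒯⁺` is generated by the sets
`basicOpen a` and `𝒯⁻` by their complements. -/
abbrev primeSpace : BitopSpace.{u} where
  carrier := BoundedLatticeHom L Prop
  pos := generateFrom (range basicOpen)
  neg := generateFrom (range fun a : L => (basicOpen a)ᶜ)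

theorem isTopologicalBasis_basicOpen :
    @IsTopologicalBasis _ (primeSpace L).pos (range (basicOpen (L := L))) := by
  have h_inter := @isTopologicalBasis_of_subbasis_of_inter _ (primeSpace L).pos _ rfl <| by
    rintro _ ⟨a, rfl⟩ _ ⟨b, rfl⟩
    exact ⟨a ⊓ b, basicOpen_inf a b⟩
  rwa [insert_eq_of_mem (mem_range.2 ⟨⊤, basicOpen_top⟩)] at h_inter

theorem isTopologicalBasis_compl_basicOpen :
    @IsTopologicalBasis _ (primeSpace L).neg (range fun a : L => (basicOpen a)ᶜ) := by
  have h_inter := @isTopologicalBasis_of_subbasis_of_inter _ (primeSpace L).neg _ rfl <| by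
    rintro _ ⟨a, rfl⟩ _ ⟨b, rfl⟩
    exact ⟨a ⊔ b, by simp only [basicOpen_sup, compl_union]⟩
  rwa [insert_eq_of_mem (mem_range.2 ⟨⊥, by rw [basicOpen_bot, compl_empty]⟩)] at h_inter

theorem basicOpen_mem_posLat (a : L) : basicOpen a ∈ (primeSpace L).posLat :=
  ⟨isOpen_generateFrom_of_mem ⟨a, rfl⟩, isOpen_generateFrom_of_mem ⟨a, rfl⟩⟩

/-- The limit of an ultrafilter on the space of prime filters, for both topologies. -/
def ultrafilterLimit (𝒰 : Ultrafilter (BoundedLatticeHom L Prop)) : BoundedLatticeHom L Prop where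
  toFun a := basicOpen a ∈ 𝒰
  map_sup' a b := propext (by rw [basicOpen_sup]; exact Ultrafilter.union_mem_iff)
  map_inf' a b := propext (by rw [basicOpen_inf]; exact inter_mem_iff)
  map_top' := eq_true (by rw [basicOpen_top]; exact univ_mem)
  map_bot' := eq_false (by rw [basicOpen_bot]; exact 𝒰.empty_notMem)

theorem le_nhds_pos_ultrafilterLimit (𝒰 : Ultrafilter (BoundedLatticeHom L Prop)) :
    (𝒰 : Filter _) ≤ @nhds _ (primeSpace L).pos (ultrafilterLimit 𝒰) := by
  refine tendsto_nhds_generateFrom_iff.2 ?_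
  rintro _ ⟨a, rfl⟩ ha
  exact ha

theorem le_nhds_neg_ultrafilterLimit (𝒰 : Ultrafilter (BoundedLatticeHom L Prop)) :
    (𝒰 : Filter _) ≤ @nhds _ (primeSpace L).neg (ultrafilterLimit 𝒰) := by
  refine tendsto_nhds_generateFrom_iff.2 ?_
  rintro _ ⟨a, rfl⟩ ha
  exact Ultrafilter.compl_mem_iff_notMem.2 ha

theorem compactSpace_patch_primeSpace : @CompactSpace _ (primeSpace L).patch := by
  rw [← @isCompact_univ_iff _ (primeSpace L).patch,
    @isCompact_iff_ultrafilter_le_nhds _ (primeSpace L).patch]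
  refine fun 𝒰 _ => ⟨ultrafilterLimit 𝒰, mem_univ _, ?_⟩
  rw [patch, @nhds_inf _ (primeSpace L).pos (primeSpace L).neg]
  exact le_inf (le_nhds_pos_ultrafilterLimit 𝒰) (le_nhds_neg_ultrafilterLimit 𝒰)

variable (L) in
theorem spectrumAxioms_primeSpace : (primeSpace L).SpectrumAxioms where
  basis_pos := by
    let _ := (primeSpace L).pos
    exact isTopologicalBasis_basicOpen.of_isOpen_of_subset (fun U hU => hU.1)
      (range_subset_iff.2 basicOpen_mem_posLat)
  basis_neg := by
    let _ := (primeSpace L).neg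
    exact isTopologicalBasis_compl_basicOpen.of_isOpen_of_subset (fun U hU => hU.1)
      (range_subset_iff.2 fun a => compl_mem_negLat_iff.2 (basicOpen_mem_posLat a))
  compact_neg := (compactSpace_patch_iff.1 compactSpace_patch_primeSpace).1
  compact_pos := (compactSpace_patch_iff.1 compactSpace_patch_primeSpace).2
  t0 := by
    let _ := (primeSpace L).pos
    refine Or.inl ⟨fun x y hxy => DFunLike.ext (F := BoundedLatticeHom L Prop) x y fun a => ?_⟩
    exact propext (hxy.mem_open_iff (basicOpen_mem_posLat a).1)

theorem exists_basicOpen_eq {U : Set (BoundedLatticeHom L Prop)}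
    (hU : U ∈ (primeSpace L).posLat) : ∃ a : L, basicOpen a = U := by
  have hU_compact := (spectrumAxioms_primeSpace L).compact_pos U hU.2
  obtain ⟨s, hs, rfl⟩ := @eq_finite_iUnion_of_isTopologicalBasis_of_isCompact_open _ _
    (primeSpace L).pos _ isTopologicalBasis_basicOpen U hU_compact hU.1
  exact ⟨hs.toFinset.sup id, by simp only [basicOpen_finset_sup, hs.mem_toFinset]⟩

/-- The complement of a prime ideal, as a prime filter. -/
def complPrimeIdeal {J : Order.Ideal L} (hJ : J.IsPrime) : BoundedLatticeHom L Prop where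
  toFun a := a ∉ J
  map_sup' a b := by simp only [Order.Ideal.sup_mem_iff, not_and_or, sup_Prop_eq]
  map_inf' a b := propext <| (not_congr
    ⟨hJ.mem_or_mem, fun h => h.elim (J.lower inf_le_left) (J.lower inf_le_right)⟩).trans not_or
  map_top' := eq_true hJ.toIsProper.top_notMem
  map_bot' := eq_false (not_not.2 J.bot_mem)

end PrimeSpace

section Distrib

variable {L : Type u} [DistribLattice L] [BoundedOrder L]

theorem basicOpen_subset_basicOpen_iff {a b : L} : basicOpen a ⊆ basicOpen b ↔ a ≤ b := by
  refine ⟨fun h => ?_, fun h x hx => OrderHomClass.mono x h hx⟩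
  by_contra hab
  obtain ⟨J, hJ, hbJ, haJ⟩ := DistribLattice.prime_ideal_of_disjoint_filter_ideal
    (F := Order.PFilter.principal a) (I := Order.Ideal.principal b)
    (disjoint_left.2 fun c hac hcb => hab (le_trans hac hcb))
  have ha : complPrimeIdeal hJ ∈ basicOpen a := disjoint_left.1 haJ (le_refl a)
  exact h ha (hbJ (Order.Ideal.mem_principal.2 le_rfl))

variable (L) in
/-- A bounded distributive lattice is the lattice `ℒ⁺` of its space of prime filters. -/
noncomputable def basicOpenIso : L ≃o (primeSpace L).posSublattice :=
  OrderIso.ofSurjective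
    (OrderEmbedding.ofMapLEIff
      (fun a => (⟨basicOpen a, basicOpen_mem_posLat a⟩ : (primeSpace L).posSublattice))
      fun _ _ => basicOpen_subset_basicOpen_iff)
    fun U => (exists_basicOpen_eq U.2).imp fun _ => Subtype.ext

end Distrib

section Duality

/-- The contravariant functor sending a bitopological space to its lattice `ℒ⁺`. -/
def posLatFunctor : BitopSpace.{u}ᵒᵖ ⥤ BddDistLat.{u} where
  obj X := BddDistLat.of X.unop.posSublattice
  map f := BddDistLat.ofHom (Hom.preimage f.unop)
  map_id _ := rfl
  map_comp _ _ := rfl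

variable {P : ObjectProperty BitopSpace.{u}} {Q : ObjectProperty BddDistLat.{u}}

theorem faithful_ι_op_comp_posLatFunctor (hP : ∀ X, P X → X.SpectrumAxioms) :
    (P.ι.op ⋙ posLatFunctor).Faithful where
  map_injective {X _ f g} hfg := by
    refine Quiver.Hom.unop_inj (P.hom_ext ?_)
    exact (hP _ X.unop.property).preimage_bijective.injective (congrArg BddDistLat.Hom.hom hfg)

theorem full_ι_op_comp_posLatFunctor (hP : ∀ X, P X → X.SpectrumAxioms) :
    (P.ι.op ⋙ posLatFunctor).Full where
  map_surjective {X _} φ := by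
    obtain ⟨f, hf⟩ := (hP _ X.unop.property).preimage_bijective.surjective φ.hom
    exact ⟨.op (ObjectProperty.homMk f), BddDistLat.hom_ext hf⟩

/-- The inverse of `basicOpenIso` as an isomorphism in `BddDistLat`. -/
noncomputable def posLatFunctorObjPrimeSpaceIso (L : BddDistLat.{u}) :
    posLatFunctor.obj (.op (primeSpace L)) ≅ L :=
  BddDistLat.Iso.mk (basicOpenIso L).symm

theorem isEquivalence_lift_posLatFunctor [Q.IsClosedUnderIsomorphisms]
    (hPQ : ∀ X, P X ↔ X.SpectrumAxioms ∧ Q (posLatFunctor.obj (.op X))) :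
    (Q.lift (P.ι.op ⋙ posLatFunctor) fun X => ((hPQ _).1 X.unop.property).2).IsEquivalence := by
  have := faithful_ι_op_comp_posLatFunctor fun X hX => ((hPQ X).1 hX).1
  have := full_ι_op_comp_posLatFunctor fun X hX => ((hPQ X).1 hX).1
  refine { essSurj := ⟨fun L => ?_⟩ }
  let e := posLatFunctorObjPrimeSpaceIso L.obj
  have hL : P (primeSpace L.obj) :=
    (hPQ _).2 ⟨spectrumAxioms_primeSpace L.obj, Q.prop_of_iso e.symm L.property⟩
  exact ⟨.op ⟨primeSpace L.obj, hL⟩, ⟨Q.isoMk e⟩⟩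

/-- The duality given by `ℒ⁺` between the abstract spectra whose lattice `ℒ⁺` satisfies `Q` and the
bounded distributive lattices satisfying `Q`. -/
noncomputable def dualEquivalence [Q.IsClosedUnderIsomorphisms]
    (hPQ : ∀ X, P X ↔ X.SpectrumAxioms ∧ Q (posLatFunctor.obj (.op X))) :
    P.FullSubcategoryᵒᵖ ≌ Q.FullSubcategory :=
  have := isEquivalence_lift_posLatFunctor hPQ
  (Q.lift (P.ι.op ⋙ posLatFunctor) fun X => ((hPQ _).1 X.unop.property).2).asEquivalence

instance : BddDistLat.isNontrivial.{u}.IsClosedUnderIsomorphisms where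
  of_iso {L M} e hL hM := hL <| by
    simpa using congrArg e.inv hM

theorem isAbstractSpectrum_iff (X : BitopSpace.{u}) :
    X.isAbstractSpectrum ↔
      X.SpectrumAxioms ∧ BddDistLat.isNontrivial (posLatFunctor.obj (.op X)) :=
  and_comm.trans (and_congr_right' bot_ne_top_posSublattice_iff.symm)

end Duality

end BitopSpace

/-- The category of possibly empty abstract spectra is dual to the category of all bounded
distributive lattices, and the category of non-empty abstract spectra is dual to the category of
bounded distributive lattices with `0 ≠ 1`. -/
theorem corollary2p3p12 :
    Nonempty (PossiblyEmptyAbstractSpectrum.{u}ᵒᵖ ≌ BddDistLat.{u}) ∧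
      Nonempty (AbstractSpectrum.{u}ᵒᵖ ≌ NontrivialBddDistLat.{u}) :=
  ⟨⟨(BitopSpace.dualEquivalence (Q := ⊤) fun _ => (and_iff_left trivial).symm).trans
      (ObjectProperty.topEquivalence _)⟩,
    ⟨BitopSpace.dualEquivalence BitopSpace.isAbstractSpectrum_iff⟩⟩
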